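/- All graphs are finite, simple and undirected. For a connected graph $G$ let $D(G)$ be its distance matrix and $\lambda_1(D(G))$ the largest eigenvalue of $D(G)$. Write $G\cup H$ for the disjoint union and $G\vee H$ for the join of two graphs, and put $S_{n,m}=K_m\vee (n-m)K_1$. For a graph $H$ let $i(H)$ be the number of its isolated vertices. For an even integer $k\ge 2$, a $k$-barrier of $G$ is a set $S\subseteq V(G)$ that maximizes $k\cdot i(G-S)-k|S|$ over all subsets of $V(G)$. A connected graph of odd (respectively even) order is called $\mathrm{GFC}_k$ (respectively $\mathrm{GBC}_k$) if it has no non-empty $k$-barrier. **Theorem.** Let $k\ge 2$ be an even integer and let $G$ be a connected graph of order $n\ge 3$. (i) If $\lambda_1(D(G))\le\lambda_1(D(K_1\vee(K_{n-2}\cup K_1)))$, then, unless $G\cong K_1\vee(K_{n-2}\cup K_1)$, $G$ is $\mathrm{GFC}_k$ if $n$ is odd, and $G$ is $\mathrm{GBC}_k$ if $n$ is even and $n\ge 10$. (ii) If $n$ is even, $4\le n\le 8$ and $\lambda_1(D(G))\le\lambda_1(D(S_{n,n/2}))$, then $G$ is $\mathrm{GBC}_k$ unless $G\cong S_{n,n/2}$.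 -/

import Mathlib

namespace DistMatching

noncomputable section

/-- The distance matrix `D(G)`: its `(u, v)` entry is the length of a shortest path from `u` to `v`. -/
def distMatrix {V : Type*} (G : SimpleGraph V) : Matrix V V ℝ :=
  Matrix.of fun u v => (G.dist u v : ℝ)

theorem distMatrix_isHermitian {V : Type*} (G : SimpleGraph V) : (distMatrix G).IsHermitian := by
  ext u v
  simp [distMatrix, Matrix.conjTranspose_apply, SimpleGraph.dist_comm]

open Classical in
/-- The distance spectral radius `λ₁(D(G))`: the largest eigenvalue of the distance matrix
(a finite supremum, over a nonempty set of eigenvalues as soon as the graph has a vertex). -/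
def distSpectralRadius {V : Type*} [Fintype V] (G : SimpleGraph V) : ℝ :=
  ⨆ v : V, (distMatrix_isHermitian G).eigenvalues v

/-- The graph `G - S`. -/
def deleteVerts {V : Type*} (G : SimpleGraph V) (S : Finset V) :
    SimpleGraph {v : V // v ∉ S} :=
  G.comap Subtype.val

/-- The number `i(G)` of isolated vertices. -/
def numIsolated {V : Type*} (G : SimpleGraph V) : ℕ :=
  {v : V | G.IsIsolated v}.ncard

/-- The number `odd(G)` of nontrivial odd components, that is, of components with an odd number
of vertices and more than one vertex. -/
def numNontrivialOdd {V : Type*} (G : SimpleGraph V) : ℕ :=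
  {c : G.ConnectedComponent | Odd c.supp.ncard ∧ 1 < c.supp.ncard}.ncard

/-- The expression maximized in the `k`-Berge–Tutte formula. -/
def bergeTutteValue {V : Type*} (G : SimpleGraph V) (k : ℕ) (S : Finset V) : ℤ :=
  if Even k then
    (k : ℤ) * (numIsolated (deleteVerts G S) : ℤ) - (k : ℤ) * (S.card : ℤ)
  else
    (numNontrivialOdd (deleteVerts G S) : ℤ) + (k : ℤ) * (numIsolated (deleteVerts G S) : ℤ)
      - (k : ℤ) * (S.card : ℤ)

/-- The `k`-Berge–Tutte formula `def_k(G)`, a maximum over all vertex subsets. -/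
def bergeTutteDef {V : Type*} [Fintype V] (G : SimpleGraph V) (k : ℕ) : ℤ :=
  (Finset.univ : Finset (Finset V)).sup' Finset.univ_nonempty (bergeTutteValue G k)

/-- A `k`-barrier: a vertex subset that reaches the maximum in the `k`-Berge–Tutte formula. -/
def IsBarrier {V : Type*} [Fintype V] (G : SimpleGraph V) (k : ℕ) (S : Finset V) : Prop :=
  bergeTutteValue G k S = bergeTutteDef G k

/-- `G` is `GFC_k`: connected, of odd order, without nonempty `k`-barrier. -/
def IsGFC {V : Type*} [Fintype V] (G : SimpleGraph V) (k : ℕ) : Prop :=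
  G.Connected ∧ Odd (Fintype.card V) ∧ ∀ S : Finset V, S.Nonempty → ¬ IsBarrier G k S

/-- `G` is `GBC_k`: connected, of even order, without nonempty `k`-barrier. -/
def IsGBC {V : Type*} [Fintype V] (G : SimpleGraph V) (k : ℕ) : Prop :=
  G.Connected ∧ Even (Fintype.card V) ∧ ∀ S : Finset V, S.Nonempty → ¬ IsBarrier G k S

/-- The join `G ∨ H`: the disjoint union together with all edges between the two parts. -/
def graphJoin {V W : Type*} (G : SimpleGraph V) (H : SimpleGraph W) : SimpleGraph (V ⊕ W) :=
  (G ⊕g H) ⊔ completeBipartiteGraph V W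

/-- The graph `K₁ ∨ (K_{n-2} ∪ K₁)`, of order `n` when `n ≥ 2`. -/
def extremalGraph (n : ℕ) : SimpleGraph (Fin 1 ⊕ (Fin (n - 2) ⊕ Fin 1)) :=
  graphJoin (⊤ : SimpleGraph (Fin 1))
    ((⊤ : SimpleGraph (Fin (n - 2))) ⊕g (⊤ : SimpleGraph (Fin 1)))

/-- The graph `S_{n,m} = K_m ∨ (n - m)K₁`, of order `n` when `m ≤ n`. -/
def splitGraph (n m : ℕ) : SimpleGraph (Fin m ⊕ Fin (n - m)) :=
  graphJoin (⊤ : SimpleGraph (Fin m)) (⊥ : SimpleGraph (Fin (n - m)))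

end

end DistMatching

/-!
A nonempty `k`-barrier `S` has value at least that of `∅`, so deleting `S` leaves at least `|S|`
isolated vertices, and `G` is a spanning subgraph of `K_s ∨ (K_r ∪ s K₁)` with `s = |S|`. Adding
edges can only shrink distances, and by Perron–Frobenius it strictly lowers the largest eigenvalue
of the distance matrix. So it remains to minimise that eigenvalue over the graphs
`K_s ∨ (K_r ∪ s K₁)` of the given order. Vectors constant on the three parts suffice for this: they
bound it from above through the Collatz–Wielandt inequality and from below through the Rayleigh
quotient.
-/

namespace DistMatching

open Matrix

section LargestEigenvalue

variable {ι κ : Type*} [Fintype ι] [Fintype κ] {A B : Matrix ι ι ℝ}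

theorem pos_of_mulVec_eq_smul {w : ι → ℝ} {μ : ℝ} (hA : ∀ i j, i ≠ j → 0 < A i j)
    (hw : 0 ≤ w) (hw0 : w ≠ 0) (hμ : A *ᵥ w = μ • w) (i : ι) : 0 < w i := by
  refine (hw i).lt_of_ne' fun hi => hw0 ?_
  have hterm : ∀ j, 0 ≤ A i j * w j := fun j => by
    obtain rfl | hij := eq_or_ne i j
    · simp [hi]
    · exact mul_nonneg (hA i j hij).le (hw j)
  have hsum : ∑ j, A i j * w j = 0 := by
    simpa [hi, mulVec, dotProduct] using congrFun hμ i
  ext j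
  obtain rfl | hij := eq_or_ne i j
  · exact hi
  · have hj := (Finset.sum_eq_zero_iff_of_nonneg fun j _ => hterm j).1 hsum j (Finset.mem_univ j)
    exact (mul_eq_zero.1 hj).resolve_left (hA i j hij).ne'

variable [DecidableEq ι] [DecidableEq κ]

theorem iSup_eigenvalues_eq_sSup_spectrum (hA : A.IsHermitian) :
    ⨆ i, hA.eigenvalues i = sSup (spectrum ℝ A) := by
  rw [hA.spectrum_real_eq_range_eigenvalues, iSup]

theorem iSup_eigenvalues_submatrix (hA : A.IsHermitian) (e : κ ≃ ι) :
    ⨆ k, (hA.submatrix e).eigenvalues k = ⨆ i, hA.eigenvalues i := by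
  rw [iSup_eigenvalues_eq_sSup_spectrum, iSup_eigenvalues_eq_sSup_spectrum]
  exact congrArg sSup (AlgEquiv.spectrum_eq (reindexAlgEquiv ℝ ℝ e.symm) A)

open scoped MatrixOrder in
theorem posSemidef_iSup_eigenvalues_sub (hA : A.IsHermitian) :
    ((⨆ i, hA.eigenvalues i) • (1 : Matrix ι ι ℝ) - A).PosSemidef := by
  rw [← Algebra.algebraMap_eq_smul_one, ← Matrix.le_iff]
  refine le_algebraMap_of_spectrum_le (fun μ hμ => ?_) hA
  obtain ⟨i, rfl⟩ := hA.spectrum_real_eq_range_eigenvalues ▸ hμ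
  exact le_ciSup (Set.finite_range _).bddAbove i

theorem dotProduct_iSup_eigenvalues_sub_mulVec (hA : A.IsHermitian) (x : ι → ℝ) :
    x ⬝ᵥ ((⨆ i, hA.eigenvalues i) • (1 : Matrix ι ι ℝ) - A) *ᵥ x =
      (⨆ i, hA.eigenvalues i) * (x ⬝ᵥ x) - x ⬝ᵥ A *ᵥ x := by
  rw [sub_mulVec, smul_mulVec, one_mulVec, dotProduct_sub, dotProduct_smul, smul_eq_mul]

theorem dotProduct_mulVec_le_iSup_eigenvalues (hA : A.IsHermitian) (x : ι → ℝ) :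
    x ⬝ᵥ A *ᵥ x ≤ (⨆ i, hA.eigenvalues i) * (x ⬝ᵥ x) := by
  have h := (posSemidef_iSup_eigenvalues_sub hA).dotProduct_mulVec_nonneg x
  rw [star_trivial, dotProduct_iSup_eigenvalues_sub_mulVec] at h
  exact sub_nonneg.1 h

theorem mulVec_eq_of_iSup_eigenvalues_mul_le (hA : A.IsHermitian) {x : ι → ℝ}
    (hx : (⨆ i, hA.eigenvalues i) * (x ⬝ᵥ x) ≤ x ⬝ᵥ A *ᵥ x) :
    A *ᵥ x = (⨆ i, hA.eigenvalues i) • x := by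
  have h := (posSemidef_iSup_eigenvalues_sub hA).dotProduct_mulVec_zero_iff x
  rw [star_trivial, dotProduct_iSup_eigenvalues_sub_mulVec, sub_mulVec, smul_mulVec,
    one_mulVec] at h
  have hx' := dotProduct_mulVec_le_iSup_eigenvalues hA x
  exact (sub_eq_zero.1 (h.1 (sub_eq_zero.2 (hx.antisymm hx')))).symm

theorem exists_mulVec_eq_iSup_eigenvalues [Nonempty ι] (hA : A.IsHermitian) :
    ∃ z : ι → ℝ, z ≠ 0 ∧ A *ᵥ z = (⨆ i, hA.eigenvalues i) • z := by
  obtain ⟨j, hj⟩ := exists_eq_ciSup_of_finite (f := hA.eigenvalues)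
  refine ⟨⇑(hA.eigenvectorBasis j), fun h => ?_, by rw [hA.mulVec_eigenvectorBasis, hj]⟩
  exact hA.eigenvectorBasis.orthonormal.ne_zero j (PiLp.ext (congrFun h))

/- Replacing an eigenvector by its absolute value does not decrease the Rayleigh quotient, so the
absolute value is again an eigenvector for the largest eigenvalue. -/
theorem exists_pos_mulVec_eq_iSup_eigenvalues [Nonempty ι] (hA : A.IsHermitian)
    (hpos : ∀ i j, i ≠ j → 0 < A i j) :
    ∃ w : ι → ℝ, (∀ i, 0 < w i) ∧ A *ᵥ w = (⨆ i, hA.eigenvalues i) • w := by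
  obtain ⟨z, hz0, hz⟩ := exists_mulVec_eq_iSup_eigenvalues hA
  have hentry : ∀ i j, z i * (A i j * z j) ≤ |z i| * (A i j * |z j|) := fun i j => by
    obtain rfl | hij := eq_or_ne i j
    · refine le_of_eq ?_
      rw [mul_left_comm, mul_left_comm |z i|, abs_mul_abs_self]
    · calc z i * (A i j * z j) ≤ |z i * (A i j * z j)| := le_abs_self _
        _ = |z i| * (A i j * |z j|) := by rw [abs_mul, abs_mul, abs_of_pos (hpos i j hij)]
  have hRayleigh : (⨆ i, hA.eigenvalues i) * (|z| ⬝ᵥ |z|) ≤ |z| ⬝ᵥ A *ᵥ |z| := calc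
    (⨆ i, hA.eigenvalues i) * (|z| ⬝ᵥ |z|) = z ⬝ᵥ A *ᵥ z := by
      rw [hz, dotProduct_smul, smul_eq_mul]
      simp only [dotProduct, Pi.abs_apply, abs_mul_abs_self]
    _ ≤ |z| ⬝ᵥ A *ᵥ |z| := by
      simp only [dotProduct, mulVec, Finset.mul_sum]
      exact Finset.sum_le_sum fun i _ => Finset.sum_le_sum fun j _ => hentry i j
  have hw := mulVec_eq_of_iSup_eigenvalues_mul_le hA hRayleigh
  have habs : |z| ≠ 0 := fun h => hz0 (funext fun i => abs_eq_zero.1 (congrFun h i))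
  exact ⟨|z|, pos_of_mulVec_eq_smul hpos (abs_nonneg z) habs hw, hw⟩

/- The Collatz–Wielandt bound: pair the inequality with the positive eigenvector. -/
theorem iSup_eigenvalues_le_of_mulVec_le [Nonempty ι] (hA : A.IsHermitian)
    (hpos : ∀ i j, i ≠ j → 0 < A i j) {x : ι → ℝ} (hx : ∀ i, 0 < x i) {θ : ℝ}
    (h : A *ᵥ x ≤ θ • x) : ⨆ i, hA.eigenvalues i ≤ θ := by
  obtain ⟨w, hw, hAw⟩ := exists_pos_mulVec_eq_iSup_eigenvalues hA hpos
  have hwx : 0 < w ⬝ᵥ x := Finset.sum_pos (fun i _ => mul_pos (hw i) (hx i)) Finset.univ_nonempty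
  refine le_of_mul_le_mul_right ?_ hwx
  calc (⨆ i, hA.eigenvalues i) * (w ⬝ᵥ x) = (A *ᵥ w) ⬝ᵥ x := by
        rw [hAw, smul_dotProduct, smul_eq_mul]
    _ = w ⬝ᵥ A *ᵥ x := by
        rw [dotProduct_mulVec, ← mulVec_transpose, ← conjTranspose_eq_transpose_of_trivial, hA.eq]
    _ ≤ w ⬝ᵥ (θ • x) := dotProduct_le_dotProduct_of_nonneg_left h fun i => (hw i).le
    _ = θ * (w ⬝ᵥ x) := by rw [dotProduct_smul, smul_eq_mul]

theorem eq_of_le_of_iSup_eigenvalues_le (hA : A.IsHermitian) (hB : B.IsHermitian)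
    (hpos : ∀ i j, i ≠ j → 0 < A i j) (hAB : ∀ i j, A i j ≤ B i j)
    (h : ⨆ i, hB.eigenvalues i ≤ ⨆ i, hA.eigenvalues i) : A = B := by
  cases isEmpty_or_nonempty ι
  · exact Subsingleton.elim _ _
  obtain ⟨w, hw, hAw⟩ := exists_pos_mulVec_eq_iSup_eigenvalues hA hpos
  have hterm : ∀ i j, w i * (A i j * w j) ≤ w i * (B i j * w j) := fun i j => by
    gcongr
    exacts [(hw i).le, (hw j).le, hAB i j]
  have hrow : ∀ i, ∑ j, w i * (A i j * w j) ≤ ∑ j, w i * (B i j * w j) := fun i =>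
    Finset.sum_le_sum fun j _ => hterm i j
  have hge : w ⬝ᵥ B *ᵥ w ≤ w ⬝ᵥ A *ᵥ w := calc
    w ⬝ᵥ B *ᵥ w ≤ (⨆ i, hB.eigenvalues i) * (w ⬝ᵥ w) := dotProduct_mulVec_le_iSup_eigenvalues hB w
    _ ≤ (⨆ i, hA.eigenvalues i) * (w ⬝ᵥ w) :=
      mul_le_mul_of_nonneg_right h (Finset.sum_nonneg fun i _ => mul_self_nonneg (w i))
    _ = w ⬝ᵥ A *ᵥ w := by rw [hAw, dotProduct_smul, smul_eq_mul]
  simp only [dotProduct, mulVec, Finset.mul_sum] at hge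
  have hsum := (Finset.sum_le_sum fun i _ => hrow i).antisymm hge
  ext i j
  have hi := (Finset.sum_eq_sum_iff_of_le fun i _ => hrow i).1 hsum i (Finset.mem_univ i)
  have hij := (Finset.sum_eq_sum_iff_of_le fun j _ => hterm i j).1 hi j (Finset.mem_univ j)
  exact mul_right_cancel₀ (hw j).ne' (mul_left_cancel₀ (hw i).ne' hij)

theorem iSup_eigenvalues_le_of_le (hA : A.IsHermitian) (hB : B.IsHermitian)
    (hpos : ∀ i j, i ≠ j → 0 < A i j) (hAB : ∀ i j, A i j ≤ B i j) :
    ⨆ i, hA.eigenvalues i ≤ ⨆ i, hB.eigenvalues i := by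
  by_contra! h
  obtain rfl := eq_of_le_of_iSup_eigenvalues_le hA hB hpos hAB h.le
  exact h.false

end LargestEigenvalue

section DistSpectralRadius

variable {V W : Type*} {G : SimpleGraph V} {H : SimpleGraph W}

theorem distMatrix_pos_of_ne (hG : G.Connected) (u v : V) (huv : u ≠ v) :
    0 < distMatrix G u v :=
  Nat.cast_pos.2 (hG.pos_dist_of_ne huv)

theorem dist_map_le (hG : G.Connected) (f : G →g H) (u v : V) :
    H.dist (f u) (f v) ≤ G.dist u v := by
  obtain ⟨p, hp⟩ := hG.exists_walk_length_eq_dist u v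
  calc H.dist (f u) (f v) ≤ (p.map f).length := SimpleGraph.dist_le _
    _ = G.dist u v := by rw [SimpleGraph.Walk.length_map, hp]

variable [Fintype V] [Fintype W]

theorem lt_distSpectralRadius {x : V → ℝ} {θ : ℝ}
    (h : θ * (x ⬝ᵥ x) < x ⬝ᵥ distMatrix G *ᵥ x) : θ < distSpectralRadius G := by
  classical
  exact lt_of_mul_lt_mul_right
    (h.trans_le (dotProduct_mulVec_le_iSup_eigenvalues (distMatrix_isHermitian G) x))
    (Finset.sum_nonneg fun v _ => mul_self_nonneg (x v))

theorem distSpectralRadius_le (hG : G.Connected) {x : V → ℝ} (hx : ∀ v, 0 < x v) {θ : ℝ}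
    (h : distMatrix G *ᵥ x ≤ θ • x) : distSpectralRadius G ≤ θ := by
  classical
  have := hG.nonempty
  exact iSup_eigenvalues_le_of_mulVec_le _ (distMatrix_pos_of_ne hG) hx h

theorem distSpectralRadius_eq_iSup_submatrix [DecidableEq V] (e : V ≃ W) :
    distSpectralRadius H = ⨆ v, ((distMatrix_isHermitian H).submatrix e).eigenvalues v := by
  classical
  rw [iSup_eigenvalues_submatrix, distSpectralRadius]

theorem distSpectralRadius_le_of_bijective_hom (hG : G.Connected) (hH : H.Connected)
    (f : G →g H) (hf : Function.Bijective f) : distSpectralRadius H ≤ distSpectralRadius G := by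
  classical
  rw [distSpectralRadius_eq_iSup_submatrix (Equiv.ofBijective f hf)]
  exact iSup_eigenvalues_le_of_le _ _
    (fun u v huv => distMatrix_pos_of_ne hH _ _ (hf.1.ne huv))
    fun u v => Nat.cast_le.2 (dist_map_le hG f u v)

theorem nonempty_iso_of_bijective_hom (hG : G.Connected) (hH : H.Connected)
    (f : G →g H) (hf : Function.Bijective f) (h : distSpectralRadius G ≤ distSpectralRadius H) :
    Nonempty (G ≃g H) := by
  classical
  let e := Equiv.ofBijective f hf
  rw [distSpectralRadius_eq_iSup_submatrix e] at h
  have hdist : (distMatrix H).submatrix e e = distMatrix G :=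
    eq_of_le_of_iSup_eigenvalues_le _ (distMatrix_isHermitian G)
      (fun u v huv => distMatrix_pos_of_ne hH _ _ (hf.1.ne huv))
      (fun u v => Nat.cast_le.2 (dist_map_le hG f u v)) h
  refine ⟨e, fun {u v} => ?_⟩
  have huv : H.dist (e u) (e v) = G.dist u v := Nat.cast_injective (congrFun₂ hdist u v)
  rw [← SimpleGraph.dist_eq_one_iff_adj, huv, SimpleGraph.dist_eq_one_iff_adj]

theorem distSpectralRadius_eq_of_iso (hG : G.Connected) (e : G ≃g H) :
    distSpectralRadius G = distSpectralRadius H :=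
  have hH : H.Connected := e.connected_iff.1 hG
  (distSpectralRadius_le_of_bijective_hom hH hG e.symm.toHom e.symm.bijective).antisymm
    (distSpectralRadius_le_of_bijective_hom hG hH e.toHom e.bijective)

end DistSpectralRadius

section BarrierGraph

variable {V : Type*} {G : SimpleGraph V}

theorem distMatrix_eq_of_isUniversal [DecidableEq V] [DecidableRel G.Adj] {c : V}
    (hc : G.IsUniversal c) : distMatrix G = of (fun _ _ => 2) - 2 • 1 - G.adjMatrix ℝ := by
  ext u v
  simp only [distMatrix, of_apply, Matrix.sub_apply, Matrix.smul_apply,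
    SimpleGraph.adjMatrix_apply]
  obtain rfl | huv := eq_or_ne u v
  · simp
  rw [Matrix.one_apply_ne huv, smul_zero, sub_zero]
  split_ifs with hadj
  · rw [SimpleGraph.dist_eq_one_iff_adj.2 hadj]
    norm_num
  · have hcu : c ≠ u := by rintro rfl; exact hadj (hc huv)
    have hcv : c ≠ v := by rintro rfl; exact hadj (hc huv.symm).symm
    have hle : G.dist u v ≤ 2 := SimpleGraph.dist_le (.cons (hc hcu).symm (hc hcv).toWalk)
    have hlt := (SimpleGraph.Connected.of_isUniversal hc).one_lt_dist_of_ne_of_not_adj huv hadj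
    rw [hle.antisymm hlt]
    norm_num

/-- The graph `K_s ∨ (K_r ∪ t K₁)`, the edge-maximal graph on `s + r + t` vertices in which
deleting `s` vertices isolates `t` others. It is the common form of `K₁ ∨ (K_{n-2} ∪ K₁)` (the
case `s = t = 1`) and `S_{n,m}` (the case `r = 0`). -/
def barrierGraph (s r t : ℕ) : SimpleGraph (Fin s ⊕ (Fin r ⊕ Fin t)) :=
  graphJoin (⊤ : SimpleGraph (Fin s)) ((⊤ : SimpleGraph (Fin r)) ⊕g (⊥ : SimpleGraph (Fin t)))

theorem extremalGraph_eq_barrierGraph (n : ℕ) : extremalGraph n = barrierGraph 1 (n - 2) 1 := by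
  rw [extremalGraph, barrierGraph, Subsingleton.elim (⊤ : SimpleGraph (Fin 1)) ⊥]

theorem nonempty_barrierGraph_iso_splitGraph {n m t : ℕ} (ht : n - m = t) :
    Nonempty (barrierGraph m 0 t ≃g splitGraph n m) := by
  subst ht
  refine ⟨Equiv.sumCongr (Equiv.refl _) (Equiv.emptySum _ _), ?_⟩
  rintro (i | i | i) (j | j | j) <;> first | exact i.elim0 | exact j.elim0 | skip
  all_goals simp [barrierGraph, splitGraph, graphJoin]

variable {s r t : ℕ}

theorem barrierGraph_adj_of_ne {u v : Fin s ⊕ (Fin r ⊕ Fin t)} (huv : u ≠ v)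
    (hu : ∀ i j, u = Sum.inr (Sum.inr i) → v ≠ Sum.inr j)
    (hv : ∀ i j, v = Sum.inr (Sum.inr i) → u ≠ Sum.inr j) : (barrierGraph s r t).Adj u v := by
  rcases u with i | i | i <;> rcases v with j | j | j <;> simp_all [barrierGraph, graphJoin]

theorem barrierGraph_isUniversal (i : Fin s) : (barrierGraph s r t).IsUniversal (Sum.inl i) :=
  fun v hv => barrierGraph_adj_of_ne hv (by simp) (by simp)

theorem barrierGraph_connected [NeZero s] : (barrierGraph s r t).Connected :=
  .of_isUniversal (barrierGraph_isUniversal 0)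

/-- The vector on the vertices of `barrierGraph s r t` that is constant on each of its three
parts. -/
def blockVec (x y z : ℝ) : Fin s ⊕ (Fin r ⊕ Fin t) → ℝ :=
  Sum.elim (fun _ => x) (Sum.elim (fun _ => y) fun _ => z)

theorem blockVec_dotProduct_blockVec (x y z x' y' z' : ℝ) :
    (blockVec x y z : Fin s ⊕ (Fin r ⊕ Fin t) → ℝ) ⬝ᵥ blockVec x' y' z' =
      s * (x * x') + r * (y * y') + t * (z * z') := by
  simp [dotProduct, blockVec, Fintype.sum_sum_type, add_assoc]

theorem sum_ite_eq_zero_else {ι : Type*} [Fintype ι] [DecidableEq ι] (i : ι) (a : ℝ) :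
    ∑ j, (if i = j then 0 else a) = (Fintype.card ι - 1) * a := by
  have h : ∀ j, (if i = j then 0 else a) = a - if i = j then a else 0 := fun j => by
    split_ifs <;> simp
  simp only [h, Finset.sum_sub_distrib, Finset.sum_ite_eq, Finset.mem_univ, if_true,
    Finset.sum_const, Finset.card_univ, nsmul_eq_mul, sub_mul, one_mul]

theorem distMatrix_barrierGraph_mulVec_blockVec [NeZero s] (x y z : ℝ) :
    distMatrix (barrierGraph s r t) *ᵥ blockVec x y z =
      blockVec ((s - 1) * x + r * y + t * z) (s * x + (r - 1) * y + 2 * t * z)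
        (s * x + 2 * r * y + 2 * (t - 1) * z) := by
  classical
  rw [distMatrix_eq_of_isUniversal (barrierGraph_isUniversal (0 : Fin s)), two_smul]
  ext u
  simp only [mulVec, dotProduct, Matrix.sub_apply, Matrix.add_apply, of_apply,
    SimpleGraph.adjMatrix_apply, Matrix.one_apply, Fintype.sum_sum_type, blockVec]
  rcases u with i | i | i <;>
    simp [barrierGraph, graphJoin, sub_mul, add_mul, sum_ite_eq_zero_else,
      Finset.sum_sub_distrib, Finset.sum_add_distrib] <;> ring

end BarrierGraph

section Minimality

variable {s r t : ℕ}

theorem distSpectralRadius_barrierGraph_le [NeZero s] {x y z θ : ℝ} (hx : 0 < x) (hy : 0 < y)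
    (hz : 0 < z) (h₁ : (s - 1) * x + r * y + t * z ≤ θ * x)
    (h₂ : s * x + (r - 1) * y + 2 * t * z ≤ θ * y)
    (h₃ : s * x + 2 * r * y + 2 * (t - 1) * z ≤ θ * z) :
    distSpectralRadius (barrierGraph s r t) ≤ θ := by
  refine distSpectralRadius_le barrierGraph_connected (x := blockVec x y z) ?_ ?_
  · rintro (_ | _ | _)
    exacts [hx, hy, hz]
  · rw [distMatrix_barrierGraph_mulVec_blockVec]
    rintro (_ | _ | _)
    exacts [h₁, h₂, h₃]

theorem lt_distSpectralRadius_barrierGraph [NeZero s] (x y z : ℝ) {θ : ℝ}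
    (h : θ * (s * (x * x) + r * (y * y) + t * (z * z)) <
      s * (x * ((s - 1) * x + r * y + t * z)) + r * (y * (s * x + (r - 1) * y + 2 * t * z)) +
        t * (z * (s * x + 2 * r * y + 2 * (t - 1) * z))) :
    θ < distSpectralRadius (barrierGraph s r t) := by
  refine lt_distSpectralRadius (x := blockVec x y z) ?_
  rwa [distMatrix_barrierGraph_mulVec_blockVec, blockVec_dotProduct_blockVec,
    blockVec_dotProduct_blockVec]

/- From here on, the weights `x, y, z` are rounded Perron vectors of the `3 × 3` matrices in
`distMatrix_barrierGraph_mulVec_blockVec`; `y` is arbitrary when the middle part is empty. -/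

theorem distSpectralRadius_barrierGraph_one_lt_of_thirteen_le {q : ℕ} (hq : 13 ≤ q) (hs : 2 ≤ s)
    (hr : 2 * s + r = q + 2) :
    distSpectralRadius (barrierGraph 1 q 1) < distSpectralRadius (barrierGraph s r s) := by
  have : NeZero s := ⟨by omega⟩
  have hr' : (2 * s + r : ℝ) = q + 2 := by exact_mod_cast hr
  have hq' : (13 : ℝ) ≤ q := by exact_mod_cast hq
  have hs' : (2 : ℝ) ≤ s := by exact_mod_cast hs
  have hr0 : (0 : ℝ) ≤ r := r.cast_nonneg
  calc distSpectralRadius (barrierGraph 1 q 1) ≤ q + 4 := by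
        refine distSpectralRadius_barrierGraph_le (x := 1) (y := 1) (z := 2) ?_ ?_ ?_ ?_ ?_ ?_ <;>
          push_cast <;> linarith
    _ < distSpectralRadius (barrierGraph s r s) := by
        refine lt_distSpectralRadius_barrierGraph 1 1 1 ?_
        have hq'' : (q : ℝ) = 2 * s + r - 2 := by linarith
        rw [hq''] at hq' ⊢
        nlinarith [mul_nonneg (sub_nonneg.2 hs') hr0,
          mul_nonneg (sub_nonneg.2 hs') (sub_nonneg.2 hq')]

theorem distSpectralRadius_barrierGraph_one_lt_of_le_twelve {q : ℕ} (hq : 7 ≤ q) (hq' : q ≤ 12)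
    (hs : 2 ≤ s) (hr : 2 * s + r = q + 2) :
    distSpectralRadius (barrierGraph 1 q 1) < distSpectralRadius (barrierGraph s r s) := by
  have : NeZero s := ⟨by omega⟩
  have hq'' : (q : ℝ) ≤ 12 := by exact_mod_cast hq'
  calc distSpectralRadius (barrierGraph 1 q 1) ≤ q + 10 / 3 := by
        refine distSpectralRadius_barrierGraph_le (x := 3) (y := 3) (z := 5) ?_ ?_ ?_ ?_ ?_ ?_ <;>
          push_cast <;> linarith
    _ < distSpectralRadius (barrierGraph s r s) := by
        refine lt_distSpectralRadius_barrierGraph 2 2 3 ?_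
        have hs' : s ≤ 7 := by omega
        have hr' : (r : ℝ) = q + 2 - 2 * s := by rw [eq_sub_iff_add_eq']; exact_mod_cast hr
        rw [hr']
        interval_cases q <;> interval_cases s <;> first | omega | norm_num

theorem distSpectralRadius_barrierGraph_one_five_one_lt (hs : 2 ≤ s) (hr : 2 * s + r = 7) :
    distSpectralRadius (barrierGraph 1 5 1) < distSpectralRadius (barrierGraph s r s) := by
  calc distSpectralRadius (barrierGraph 1 5 1) ≤ 55 / 7 := by
        refine distSpectralRadius_barrierGraph_le (x := 5) (y := 5) (z := 7) ?_ ?_ ?_ ?_ ?_ ?_ <;>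
          norm_num
    _ < distSpectralRadius (barrierGraph s r s) := by
        obtain ⟨rfl, rfl⟩ | ⟨rfl, rfl⟩ : s = 2 ∧ r = 3 ∨ s = 3 ∧ r = 1 := by omega
        all_goals exact lt_distSpectralRadius_barrierGraph 1 2 2 (by norm_num)

theorem distSpectralRadius_barrierGraph_one_three_one_lt :
    distSpectralRadius (barrierGraph 1 3 1) < distSpectralRadius (barrierGraph 2 1 2) := by
  calc distSpectralRadius (barrierGraph 1 3 1) ≤ 59 / 11 := by
        refine distSpectralRadius_barrierGraph_le (x := 9) (y := 11) (z := 14) ?_ ?_ ?_ ?_ ?_ ?_ <;>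
          norm_num
    _ < distSpectralRadius (barrierGraph 2 1 2) :=
        lt_distSpectralRadius_barrierGraph 2 3 3 (by norm_num)

theorem distSpectralRadius_barrierGraph_one_lt {q : ℕ} (hq : Odd q ∨ 8 ≤ q) (hs : 2 ≤ s)
    (hr : 2 * s + r = q + 2) :
    distSpectralRadius (barrierGraph 1 q 1) < distSpectralRadius (barrierGraph s r s) := by
  obtain hq | hq | rfl | rfl : 13 ≤ q ∨ 7 ≤ q ∧ q ≤ 12 ∨ q = 5 ∨ q = 3 := by
    rcases hq with ⟨c, rfl⟩ | hq <;> omega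
  · exact distSpectralRadius_barrierGraph_one_lt_of_thirteen_le hq hs hr
  · exact distSpectralRadius_barrierGraph_one_lt_of_le_twelve hq.1 hq.2 hs hr
  · exact distSpectralRadius_barrierGraph_one_five_one_lt hs hr
  · obtain ⟨rfl, rfl⟩ : s = 2 ∧ r = 1 := by omega
    exact distSpectralRadius_barrierGraph_one_three_one_lt

theorem distSpectralRadius_barrierGraph_zero_lt {m : ℕ} (hm : m ≤ 4) (hs : 1 ≤ s) (hsm : s < m)
    (hr : 2 * s + r = 2 * m) :
    distSpectralRadius (barrierGraph m 0 m) < distSpectralRadius (barrierGraph s r s) := by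
  have hm2 : 2 ≤ m := by omega
  interval_cases m
  · obtain ⟨rfl, rfl⟩ : s = 1 ∧ r = 2 := by omega
    calc distSpectralRadius (barrierGraph 2 0 2) ≤ 4 := by
          refine distSpectralRadius_barrierGraph_le (x := 1) (y := 2) (z := 1) ?_ ?_ ?_ ?_ ?_ ?_ <;>
            norm_num
      _ < distSpectralRadius (barrierGraph 1 2 1) :=
          lt_distSpectralRadius_barrierGraph 2 3 3 (by norm_num)
  · calc distSpectralRadius (barrierGraph 3 0 3) ≤ 13 / 2 := by
          refine distSpectralRadius_barrierGraph_le (x := 2) (y := 4) (z := 3) ?_ ?_ ?_ ?_ ?_ ?_ <;>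
            norm_num
      _ < distSpectralRadius (barrierGraph s r s) := by
          obtain ⟨rfl, rfl⟩ | ⟨rfl, rfl⟩ : s = 1 ∧ r = 4 ∨ s = 2 ∧ r = 2 := by omega
          all_goals exact lt_distSpectralRadius_barrierGraph 3 4 5 (by norm_num)
  · calc distSpectralRadius (barrierGraph 4 0 4) ≤ 79 / 9 := by
          refine distSpectralRadius_barrierGraph_le (x := 9) (y := 15) (z := 13)
            ?_ ?_ ?_ ?_ ?_ ?_ <;> norm_num
      _ < distSpectralRadius (barrierGraph s r s) := by
          obtain ⟨rfl, rfl⟩ | ⟨rfl, rfl⟩ | ⟨rfl, rfl⟩ :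
            s = 1 ∧ r = 6 ∨ s = 2 ∧ r = 4 ∨ s = 3 ∧ r = 2 := by omega
          · exact lt_distSpectralRadius_barrierGraph 11 13 19 (by norm_num)
          all_goals exact lt_distSpectralRadius_barrierGraph 2 3 3 (by norm_num)

end Minimality

section Barrier

variable {V : Type*} {G : SimpleGraph V} {k m q : ℕ} {S : Finset V}

theorem exists_bijective_hom_barrierGraph [Finite V] {t : ℕ}
    (ht : t ≤ numIsolated (deleteVerts G S)) :
    ∃ r, ∃ f : G →g barrierGraph S.card r t, Function.Bijective f := by
  classical
  obtain ⟨T, hT, hTcard⟩ := Set.exists_subset_card_eq ht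
  let eCompl : Fin (Nat.card ↥Tᶜ) ⊕ Fin t ≃ {v // v ∉ S} :=
    ((Finite.equivFin ↥Tᶜ).sumCongr (Finite.equivFinOfCardEq hTcard)).symm.trans
      ((Equiv.sumComm _ _).trans (Equiv.Set.sumCompl T))
  let e : Fin S.card ⊕ (Fin (Nat.card ↥Tᶜ) ⊕ Fin t) ≃ V :=
    (S.equivFin.symm.sumCongr eCompl).trans (Equiv.sumCompl (· ∈ S))
  have hisolated : ∀ i j, ¬ G.Adj (e (Sum.inr (Sum.inr i))) (e (Sum.inr j)) := fun i j =>
    hT (Subtype.property ((Finite.equivFinOfCardEq hTcard).symm i)) (eCompl j)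
  have hadj : ∀ x y, G.Adj (e x) (e y) → (barrierGraph S.card _ t).Adj x y := fun x y hxy => by
    refine barrierGraph_adj_of_ne (fun h => hxy.ne (congrArg e h)) ?_ ?_ <;> rintro i j rfl rfl
    exacts [hisolated i j hxy, hisolated i j hxy.symm]
  refine ⟨_, ⟨e.symm, fun {u v} h => hadj _ _ ?_⟩, e.symm.bijective⟩
  rwa [e.apply_symm_apply, e.apply_symm_apply]

variable [Fintype V]

/- The empty set has value `k * i(G) ≥ 0`, so every `k`-barrier has nonnegative value. -/
theorem IsBarrier.card_le_numIsolated (hS : IsBarrier G k S) (hk : 0 < k) (hk_even : Even k) :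
    S.card ≤ numIsolated (deleteVerts G S) := by
  have hle : bergeTutteValue G k ∅ ≤ bergeTutteValue G k S :=
    hS ▸ Finset.le_sup' (bergeTutteValue G k) (Finset.mem_univ ∅)
  simp only [bergeTutteValue, if_pos hk_even, Finset.card_empty, Nat.cast_zero, mul_zero,
    sub_zero] at hle
  have hnonneg : 0 ≤ (k : ℤ) * numIsolated (deleteVerts G ∅) := by positivity
  have hmul : (k : ℤ) * S.card ≤ k * numIsolated (deleteVerts G S) := by linarith
  exact_mod_cast le_of_mul_le_mul_left hmul (Int.natCast_pos.2 hk)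

theorem IsBarrier.nonempty_iso_barrierGraph [NeZero m] (hS : IsBarrier G k S) (hk : 0 < k)
    (hk_even : Even k) (hS0 : S.Nonempty) (hG : G.Connected) (hV : Fintype.card V = 2 * m + q)
    (hρ : distSpectralRadius G ≤ distSpectralRadius (barrierGraph m q m))
    (hmin : ∀ s r, 1 ≤ s → s ≠ m → 2 * s + r = 2 * m + q →
      distSpectralRadius (barrierGraph m q m) < distSpectralRadius (barrierGraph s r s)) :
    Nonempty (G ≃g barrierGraph m q m) := by
  obtain ⟨r, f, hf⟩ := exists_bijective_hom_barrierGraph (hS.card_le_numIsolated hk hk_even)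
  have : NeZero S.card := ⟨hS0.card_ne_zero⟩
  have hcard : 2 * S.card + r = 2 * m + q := by
    have := Fintype.card_of_bijective hf
    simp only [hV, Fintype.card_sum, Fintype.card_fin] at this
    omega
  have hle := distSpectralRadius_le_of_bijective_hom hG barrierGraph_connected f hf
  obtain hSm : S.card = m := by
    by_contra hne
    exact (hle.trans hρ).not_gt (hmin _ _ hS0.card_pos hne hcard)
  obtain rfl : r = q := by omega
  subst hSm
  exact nonempty_iso_of_bijective_hom hG barrierGraph_connected f hf hρ

end Barrier

end DistMatching

theorem theorem5 {V : Type*} [Fintype V] (G : SimpleGraph V) (k n : ℕ)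
    (hk : 2 ≤ k) (hk_even : Even k) (hG : G.Connected)
    (hn : Fintype.card V = n) (hn3 : 3 ≤ n) :
    (DistMatching.distSpectralRadius G
        ≤ DistMatching.distSpectralRadius (DistMatching.extremalGraph n) →
      ¬ Nonempty (G ≃g DistMatching.extremalGraph n) →
        (Odd n → DistMatching.IsGFC G k) ∧ (Even n → 10 ≤ n → DistMatching.IsGBC G k)) ∧
    (DistMatching.distSpectralRadius G
        ≤ DistMatching.distSpectralRadius (DistMatching.splitGraph n (n / 2)) →
      ¬ Nonempty (G ≃g DistMatching.splitGraph n (n / 2)) →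
        Even n → 4 ≤ n → n ≤ 8 → DistMatching.IsGBC G k) := by
  open DistMatching in
  have hk0 : 0 < k := two_pos.trans_le hk
  constructor
  · rw [extremalGraph_eq_barrierGraph]
    intro hρ hiso
    have hbarrier (hn' : Odd (n - 2) ∨ 8 ≤ n - 2) (S : Finset V) (hS : S.Nonempty) :
        ¬ IsBarrier G k S := fun hSk =>
      hiso <| hSk.nonempty_iso_barrierGraph hk0 hk_even hS hG (by omega) hρ fun s r hs hs1 hr =>
        distSpectralRadius_barrierGraph_one_lt hn' (by omega) (by omega)
    exact ⟨fun ho => ⟨hG, hn ▸ ho, hbarrier (.inl (Nat.Odd.sub_even (by omega) ho even_two))⟩,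
      fun he h10 => ⟨hG, hn ▸ he, hbarrier (.inr (by omega))⟩⟩
  · rintro hρ hiso ⟨m, rfl⟩ h4 h8
    have : NeZero m := ⟨by omega⟩
    rw [show (m + m) / 2 = m by omega] at hρ hiso
    obtain ⟨e⟩ := nonempty_barrierGraph_iso_splitGraph (Nat.add_sub_cancel (n := m) (m := m))
    rw [← distSpectralRadius_eq_of_iso barrierGraph_connected e] at hρ
    have hiso' : ¬ Nonempty (G ≃g barrierGraph m 0 m) := fun ⟨f⟩ => hiso ⟨f.trans e⟩
    exact ⟨hG, hn ▸ ⟨m, rfl⟩, fun S hS hSk => hiso' <|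
      hSk.nonempty_iso_barrierGraph hk0 hk_even hS hG (by omega) hρ fun s r hs hsm hr =>
        distSpectralRadius_barrierGraph_zero_lt (by omega) hs (by omega) hr⟩
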